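/- Let $m,k\ge 0$ be integers, let $[\cdot,\cdot]:\mathbf R^m\times\mathbf R^m\to\mathbf R^k$ be a nonzero skew-symmetric bilinear map, and let $\varphi:[0,\infty)\times[0,\infty)\to[0,\infty)$ be a smooth (up to the boundary), compactly supported function that is not identically zero. Let the torus $T=(2\pi\mathbf Z)^k\backslash\mathbf R^k\cong \mathrm{SO}(2)\times\dots\times\mathrm{SO}(2)$ act on $\mathbf R^{2k}=\mathbf R^2\times\dots\times\mathbf R^2$ by the standard rotation in each factor, and on $\mathbf R^{m+2k}=\mathbf R^m\times\mathbf R^{2k}$ by $z\cdot(x,u)=(x,z\cdot u)$. For $Z$ in the Lie algebra $\mathbf R^k$ of $T$ put $Z^*_u=\frac{d}{dt}\big|_{t=0}\exp(tZ)\cdot u$. Let $g=g^{[\cdot,\cdot],\varphi}$ be the Riemannian metric on $\mathbf R^{m+2k}$ determined at each point $(x,u)$ as follows. For $Y\in\mathbf R^m$ put $\tilde Y=\bigl(Y,\ \varphi(\|x\|^2,\|u\|^2)\,[x,Y]^*_u\bigr)\in T_{(x,u)}\mathbf R^{m+2k}=\mathbf R^m\oplus\mathbf R^{2k}$. Then $g((0,W),(0,V))=\langle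 W,V\rangle$ for $W,V\in\mathbf R^{2k}$; the $g$-orthogonal complement of $\{0\}\oplus\mathbf R^{2k}$ is $\{\tilde Y: Y\in\mathbf R^m\}$; and $g(\tilde Y,\tilde Y')=\langle Y,Y'\rangle$ for $Y,Y'\in\mathbf R^m$. Then $T$ acts by isometries of $g$, and the centralizer of $T$ in the group of all isometries of $g$ (diffeomorphisms $\tau$ of $\mathbf R^{m+2k}$ with $\tau^*g=g$) consists exactly of the maps $$\tau(x,u)=(A(x),\,z\cdot u)$$ such that $z\in T$ and $A\in \mathrm O(m)$ satisfies $[Ax,Ay]=[x,y]$ for all $x,y\in\mathbf R^m$. -/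

import Mathlib

open scoped NNReal ContDiff Manifold

noncomputable section

namespace TorusMetric

/-- Smooth Riemannian metrics on a normed vector space `E`. -/
abbrev RMetric (E : Type*) [NormedAddCommGroup E] [NormedSpace ℝ E] : Type _ :=
  Bundle.ContMDiffRiemannianMetric 𝓘(ℝ, E) ∞ E (fun p : E => TangentSpace 𝓘(ℝ, E) p)

/-- In a vector space, the trivialization of the bundle of bilinear forms on the tangent spaces
is the obvious one. -/
lemma inCoordinates_eq {E : Type*} [NormedAddCommGroup E] [NormedSpace ℝ E] (p q : E)
    (g : TangentSpace 𝓘(ℝ, E) q →L[ℝ] TangentSpace 𝓘(ℝ, E) q →L[ℝ] ℝ) (v w : E) :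
    ContinuousLinearMap.inCoordinates E (fun p : E => TangentSpace 𝓘(ℝ, E) p) (E →L[ℝ] ℝ)
      (fun p : E => TangentSpace 𝓘(ℝ, E) p →L[ℝ] ℝ) p q p q g v w = g v w := by
  have h : (Bundle.Trivialization.symmL ℝ (trivializationAt E (fun p : E => TangentSpace 𝓘(ℝ, E) p) p) q) = ContinuousLinearMap.id ℝ E := TangentBundle.symmL_model_space p q
  have h2 : ∀ f : TangentSpace 𝓘(ℝ, E) q →L[ℝ] ℝ, 
     Bundle.Trivialization.continuousLinearMapAt ℝ (trivializationAt (E →L[ℝ] ℝ) (fun p : E => TangentSpace 𝓘(ℝ, E) p →L[ℝ] ℝ) p) q f w = f w := by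
    intro f
    rw [Bundle.Trivialization.continuousLinearMapAt_apply]
    rw [Bundle.Trivialization.linearMapAt_apply]
    rw [if_pos (by simp; exact Set.mem_univ q)]
    rw [hom_trivializationAt_apply]
    dsimp only [ContinuousLinearMap.inCoordinates]
    simp only [ContinuousLinearMap.comp_apply]
    rw [DFunLike.congr_fun h w]
    simp
    rfl
  unfold ContinuousLinearMap.inCoordinates
  rw [ContinuousLinearMap.comp_apply, ContinuousLinearMap.comp_apply]
  rw [DFunLike.congr_fun h v]
  exact h2 (g v)

/-- A smooth family of bilinear forms on `E` is a smooth section of the bundle of bilinear forms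
on the tangent spaces of `E`. -/
lemma contMDiff_of_contDiff {E : Type*} [NormedAddCommGroup E] [NormedSpace ℝ E] (b : E → E →L[ℝ] E →L[ℝ] ℝ) 
   (smooth : ContDiff ℝ ∞ b) :
   ContMDiff 𝓘(ℝ, E) (𝓘(ℝ, E).prod 𝓘(ℝ, E →L[ℝ] E →L[ℝ] ℝ)) ∞
    (fun p : E ↦ Bundle.TotalSpace.mk' (E →L[ℝ] E →L[ℝ] ℝ) (E := fun p : E => TangentSpace 𝓘(ℝ, E) p →L[ℝ] TangentSpace 𝓘(ℝ, E) p →L[ℝ] ℝ) p (b p)) := by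
    intro p
    refine (Bundle.contMDiffAt_section p).2 ?_
    refine ContMDiffAt.congr_of_eventuallyEq (smooth.contMDiff.contMDiffAt (x := p)) (Filter.Eventually.of_forall fun q => ?_)
    refine ContinuousLinearMap.ext fun v => ContinuousLinearMap.ext fun w => ?_
    exact inCoordinates_eq p q (b q) v w

/-- A smooth family of inner products on `E` is a Riemannian metric on `E`. -/
def RMetric.mk' {E : Type*} [NormedAddCommGroup E] [NormedSpace ℝ E] (b : E → E →L[ℝ] E →L[ℝ] ℝ)
    (symm : ∀ p v w, b p v w = b p w v) (pos : ∀ p v, v ≠ 0 → 0 < b p v v)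
    (bdd : ∀ p, Bornology.IsVonNBounded ℝ {v : E | b p v v < 1}) (smooth : ContDiff ℝ ∞ b) :
    RMetric E where
  inner p := b p
  symm p v w := symm p v w
  pos p v hv := pos p v hv
  isVonNBounded p := bdd p
  contMDiff := contMDiff_of_contDiff b smooth

/-- The group of isometries of a Riemannian metric `g` on a vector space `E`: the smooth
diffeomorphisms `τ` of `E` with `τ^* g = g`. -/
def isometryGroup {E : Type*} [NormedAddCommGroup E] [NormedSpace ℝ E]
    (g : RMetric E) :
    Subgroup (Equiv.Perm E) where
  carrier := {τ | ContDiff ℝ ∞ τ ∧ ContDiff ℝ ∞ τ.symm ∧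
    ∀ p v w : E, g.inner (τ p) (fderiv ℝ τ p v) (fderiv ℝ τ p w) = g.inner p v w}
  one_mem' := ⟨contDiff_id, contDiff_id, fun p v w => by
    have h : fderiv ℝ (⇑(1 : Equiv.Perm E)) p = ContinuousLinearMap.id ℝ E := fderiv_id
    rw [h]; rfl⟩
  mul_mem' := by
    rintro σ τ ⟨h1, h2, h3⟩ ⟨h1', h2', h3'⟩
    refine ⟨h1.comp h1', h2'.comp h2, fun p v w => ?_⟩
    have h : fderiv ℝ (⇑(σ * τ)) p = (fderiv ℝ σ (τ p)).comp (fderiv ℝ τ p) :=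
      fderiv_comp p (h1.differentiable (by simp) _) (h1'.differentiable (by simp) _)
    rw [h, ← h3' p v w, ← h3 (τ p)]
    rfl
  inv_mem' := by
    rintro τ ⟨h1, h2, h3⟩
    refine ⟨h2, h1, fun p v w => ?_⟩
    have h : (fderiv ℝ τ (τ.symm p)).comp (fderiv ℝ τ.symm p) = ContinuousLinearMap.id ℝ E := by
      rw [← fderiv_comp p (h1.differentiable (by simp) _) (h2.differentiable (by simp) _)]
      rw [Equiv.self_comp_symm]
      exact fderiv_id
    have h' : ∀ v, fderiv ℝ τ (τ.symm p) (fderiv ℝ τ.symm p v) = v := fun v =>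
      DFunLike.congr_fun h v
    have key := h3 (τ.symm p) (fderiv ℝ τ.symm p v) (fderiv ℝ τ.symm p w)
    rw [h', h', Equiv.apply_symm_apply] at key
    exact key.symm

/-- `ℝ^m` with its Euclidean structure. -/
abbrev Rm (m : ℕ) : Type := EuclideanSpace ℝ (Fin m)

/-- `ℝ^{2k} = ℝ^2 × ⋯ × ℝ^2`, each plane `ℝ^2` being identified with `ℂ`; it is regarded as a real
inner product space with its Euclidean inner product. -/
abbrev R2k (k : ℕ) : Type := EuclideanSpace ℂ (Fin k)

/-- `ℝ^{m+2k}`, whose elements are written `(x, u)` with `x ∈ ℝ^m` and `u ∈ ℝ^{2k}`.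
(Only the smooth structure of this product is used, never its norm.) -/
abbrev Tot (m k : ℕ) : Type := Rm m × R2k k

/-- The `k`-torus, as a product of `k` circle groups. -/
abbrev Torus (k : ℕ) : Type := Fin k → Circle

/-- The standard action of the torus on `ℝ^{2k}`: the `j`-th circle factor rotates the `j`-th
plane. -/
def rot {k : ℕ} (z : Torus k) (u : R2k k) : R2k k :=
  WithLp.toLp 2 fun j => (z j : ℂ) * u j

@[simp] lemma rot_apply {k : ℕ} (z : Torus k) (u : R2k k) (j : Fin k) :
    rot z u j = (z j : ℂ) * u j := rfl

/-- The exponential map of the torus, from its Lie algebra `ℝ^k = 𝔰𝔬(2) ⊕ ⋯ ⊕ 𝔰𝔬(2)`.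
It is a surjective homomorphism with kernel `(2πℤ)^k`. -/
def torusExp {k : ℕ} (Z : EuclideanSpace ℝ (Fin k)) : Torus k := fun j => Circle.exp (Z j)

/-- The action of the torus on `ℝ^{m+2k}`, `z · (x, u) = (x, z · u)`, as a homomorphism to the
group of bijections of `ℝ^{m+2k}`. -/
def torusAction (m k : ℕ) : Torus k →* Equiv.Perm (Tot m k) where
  toFun z :=
    { toFun := fun p => (p.1, rot z p.2)
      invFun := fun p => (p.1, rot z⁻¹ p.2)
      left_inv := fun p => by
        ext j
        · rfl
        · simp
      right_inv := fun p => by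
        ext j
        · rfl
        · simp }
  map_one' := by
    ext p j
    · rfl
    · simp
  map_mul' z w := by
    ext p j
    · rfl
    · simp [mul_assoc]

/-- The torus `T`, as a group of transformations of `ℝ^{m+2k}`. -/
def torusGroup (m k : ℕ) : Subgroup (Equiv.Perm (Tot m k)) := (torusAction m k).range

/-- The fundamental vector field `Z^*` on `ℝ^{2k}`, at the point `u`:
the derivative at `t = 0` of `exp (t Z) · u`. -/
def fundamentalField {k : ℕ} (Z : EuclideanSpace ℝ (Fin k)) (u : R2k k) : R2k k :=
  deriv (fun t : ℝ => rot (torusExp (t • Z)) u) 0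

lemma hasDerivAt_rot {k : ℕ} (Z : EuclideanSpace ℝ (Fin k)) (u : R2k k) :
    HasDerivAt (fun t : ℝ => rot (torusExp (t • Z)) u)
      (WithLp.toLp 2 fun j => (Z j : ℂ) * Complex.I * u j) 0 := by
  have h : HasDerivAt (fun (t : ℝ) (j : Fin k) => (Circle.exp (t * Z j) : ℂ) * u j)
      (fun j => (Z j : ℂ) * Complex.I * u j) 0 := by
    rw [hasDerivAt_pi]
    intro j
    simp only [Circle.coe_exp]
    have h1 : HasDerivAt (fun t : ℝ => ((t * Z j : ℝ) : ℂ)) ((Z j : ℝ) : ℂ) 0 := by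
      simpa using ((hasDerivAt_id (0 : ℝ)).mul_const (Z j)).ofReal_comp
    have h2 := ((h1.mul_const Complex.I).cexp).mul_const (u j)
    simpa using h2
  exact (PiLp.continuousLinearEquiv 2 ℝ (fun _ : Fin k => ℂ)).symm.hasFDerivAt.comp_hasDerivAt 0 h

lemma fundamentalField_eq {k : ℕ} (Z : EuclideanSpace ℝ (Fin k)) (u : R2k k) :
    fundamentalField Z u = WithLp.toLp 2 fun j => (Z j : ℂ) * Complex.I * u j :=
  (hasDerivAt_rot Z u).deriv

/-- The map `(Z, u) ↦ Z^*_u` as a bilinear map. -/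
def fundamentalFieldL (k : ℕ) : EuclideanSpace ℝ (Fin k) →L[ℝ] R2k k →L[ℝ] R2k k :=
  LinearMap.toContinuousLinearMap
    ((LinearMap.toContinuousLinearMap (𝕜 := ℝ) (E := R2k k) (F' := R2k k)).toLinearMap ∘ₗ
      LinearMap.mk₂ ℝ (fun (Z : EuclideanSpace ℝ (Fin k)) (u : R2k k) => fundamentalField Z u)
        (fun Z Z' u => by
          ext j; simp [fundamentalField_eq]; ring)
        (fun c Z u => by
          ext j; simp [fundamentalField_eq]; ring)
        (fun Z u u' => by
          ext j; simp [fundamentalField_eq]; ring)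
        (fun c Z u => by
          ext j; simp [fundamentalField_eq]; ring))

@[simp] lemma fundamentalFieldL_apply {k : ℕ} (Z : EuclideanSpace ℝ (Fin k)) (u : R2k k) :
    fundamentalFieldL k Z u = fundamentalField Z u := rfl

/-- Smoothness, up to the boundary, of a function on the closed quadrant `[0, ∞) × [0, ∞)`. -/
def SmoothOnQuadrant (φ : ℝ≥0 × ℝ≥0 → ℝ≥0) : Prop :=
  ContDiffOn ℝ ∞ (fun p : ℝ × ℝ => (φ (p.1.toNNReal, p.2.toNNReal) : ℝ))
    (Set.Ici 0 ×ˢ Set.Ici 0)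

/-- The function `ψ (x, u) = φ (‖x‖², ‖u‖²)` on `ℝ^{m+2k}`. -/
def psi {m k : ℕ} (φ : ℝ≥0 × ℝ≥0 → ℝ≥0) (p : Tot m k) : ℝ :=
  (φ (‖p.1‖₊ ^ 2, ‖p.2‖₊ ^ 2) : ℝ)

lemma contDiff_psi {m k : ℕ} {φ : ℝ≥0 × ℝ≥0 → ℝ≥0} (hφ : SmoothOnQuadrant φ) :
    ContDiff ℝ ∞ (psi (m := m) (k := k) φ) := by
  have h1 : ContDiff ℝ ∞ (fun p : Tot m k => ((‖p.1‖ ^ 2, ‖p.2‖ ^ 2) : ℝ × ℝ)) :=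
    (contDiff_fst.norm_sq ℝ).prodMk (contDiff_snd.norm_sq ℝ)
  have h2 := ContDiffOn.comp_contDiff hφ h1
    (fun p => ⟨by simp, by simp⟩)
  convert h2 using 1
  ext p
  simp only [psi, Function.comp]
  congr 3
  · ext; simp
  · ext; simp

variable {m k : ℕ}

/-- A bilinear map `ℝ^m × ℝ^m → ℝ^k`. -/
abbrev Bracket (m k : ℕ) : Type := Rm m →ₗ[ℝ] Rm m →ₗ[ℝ] EuclideanSpace ℝ (Fin k)

/-- The lift `Ỹ = (Y, ψ(x,u) [x,Y]^*_u)` to the point `(x, u)` of a vector `Y` in `ℝ^m`. -/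
def lift (B : Bracket m k) (φ : ℝ≥0 × ℝ≥0 → ℝ≥0) (p : Tot m k) (Y : Rm m) : Tot m k :=
  (Y, psi φ p • fundamentalField (B p.1 Y) p.2)

/-- The component along `{0} ⊕ ℝ^{2k}` of a vector `(Y, W)` at `p`, in the decomposition
`(Y, W) = Ỹ + (0, W - ψ(x,u) [x,Y]^*_u)`. -/
def vert (B : Bracket m k) (φ : ℝ≥0 × ℝ≥0 → ℝ≥0) (p : Tot m k) : Tot m k →L[ℝ] R2k k :=
  ContinuousLinearMap.snd ℝ (Rm m) (R2k k) -
    psi φ p • (((fundamentalFieldL k).flip p.2).comp (LinearMap.toContinuousBilinearMap B p.1)).comp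
      (ContinuousLinearMap.fst ℝ (Rm m) (R2k k))

@[simp] lemma vert_apply (B : Bracket m k) (φ : ℝ≥0 × ℝ≥0 → ℝ≥0) (p v : Tot m k) :
    vert B φ p v = v.2 - psi φ p • fundamentalField (B p.1 v.1) p.2 := rfl

lemma contDiff_vert (B : Bracket m k) {φ : ℝ≥0 × ℝ≥0 → ℝ≥0} (hφ : SmoothOnQuadrant φ) :
    ContDiff ℝ ∞ (vert B φ) := by
  unfold vert
  refine contDiff_const.sub ((contDiff_psi hφ).smul ?_)
  refine ContDiff.clm_comp (ContDiff.clm_comp ?_ ?_) contDiff_const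
  · exact (fundamentalFieldL k).flip.contDiff.comp contDiff_snd
  · exact (LinearMap.toContinuousBilinearMap B).contDiff.comp contDiff_fst

/-- The inner product on the tangent space at `p`: the decomposition `(Y, W) = Ỹ + (0, W')` is
orthogonal, `Ỹ` has the length of `Y` and `(0, W')` has the length of `W'`. -/
def form (B : Bracket m k) (φ : ℝ≥0 × ℝ≥0 → ℝ≥0) (p : Tot m k) :
    Tot m k →L[ℝ] Tot m k →L[ℝ] ℝ :=
  (innerSL ℝ (E := Rm m)).bilinearComp (ContinuousLinearMap.fst ℝ (Rm m) (R2k k))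
      (ContinuousLinearMap.fst ℝ (Rm m) (R2k k)) +
    (innerSL ℝ (E := R2k k)).bilinearComp (vert B φ p) (vert B φ p)

lemma form_apply (B : Bracket m k) (φ : ℝ≥0 × ℝ≥0 → ℝ≥0) (p v w : Tot m k) :
    form B φ p v w = inner ℝ v.1 w.1 + inner ℝ (vert B φ p v) (vert B φ p w) := rfl

/-- The three properties that define the inner product `form B φ p` (they determine it, as
every vector is the sum of a lift and a vector in `{0} ⊕ ℝ^{2k}`). -/
lemma form_spec (B : Bracket m k) (φ : ℝ≥0 × ℝ≥0 → ℝ≥0) (p : Tot m k) :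
    (∀ W V : R2k k, form B φ p (0, W) (0, V) = inner ℝ W V) ∧
    (∀ (Y : Rm m) (W : R2k k), form B φ p (lift B φ p Y) (0, W) = 0) ∧
    (∀ Y Y' : Rm m, form B φ p (lift B φ p Y) (lift B φ p Y') = inner ℝ Y Y') := by
  have h0 : fundamentalField (0 : EuclideanSpace ℝ (Fin k)) p.2 = 0 := by
    ext j; simp [fundamentalField_eq]
  refine ⟨fun W V => ?_, fun Y W => ?_, fun Y Y' => ?_⟩ <;>
    simp [form_apply, lift, h0]

lemma contDiff_form (B : Bracket m k) {φ : ℝ≥0 × ℝ≥0 → ℝ≥0} (hφ : SmoothOnQuadrant φ) :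
    ContDiff ℝ ∞ (form B φ) := by
  refine contDiff_clm_apply_iff.2 fun v => contDiff_clm_apply_iff.2 fun w => ?_
  simp only [form_apply]
  exact contDiff_const.add
    (((contDiff_vert B hφ).clm_apply contDiff_const).inner ℝ
      ((contDiff_vert B hφ).clm_apply contDiff_const))

lemma form_pos (B : Bracket m k) (φ : ℝ≥0 × ℝ≥0 → ℝ≥0) (p v : Tot m k) (hv : v ≠ 0) :
    0 < form B φ p v v := by
  rw [form_apply]
  by_cases h : v.1 = 0
  · have h2 : v.2 ≠ 0 := fun h2 => hv (Prod.ext h h2)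
    have h0 : fundamentalField (0 : EuclideanSpace ℝ (Fin k)) p.2 = 0 := by
      ext j; simp [fundamentalField_eq]
    have h3 : vert B φ p v = v.2 := by simp [h, h0]
    rw [h3, h, inner_zero_left, zero_add]
    exact real_inner_self_pos.2 h2
  · exact add_pos_of_pos_of_nonneg (real_inner_self_pos.2 h) real_inner_self_nonneg

lemma form_bounded (B : Bracket m k) (φ : ℝ≥0 × ℝ≥0 → ℝ≥0) (p : Tot m k) :
    Bornology.IsVonNBounded ℝ {v : Tot m k | form B φ p v v < 1} := by
  rw [NormedSpace.isVonNBounded_iff]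
  set L := (vert B φ p - ContinuousLinearMap.snd ℝ (Rm m) (R2k k)).comp
    (ContinuousLinearMap.inl ℝ (Rm m) (R2k k)) with hL
  refine (Metric.isBounded_closedBall (x := (0 : Tot m k)) (r := 1 + ‖L‖)).subset ?_
  intro v hv
  have hv : form B φ p v v < 1 := hv
  rw [form_apply, real_inner_self_eq_norm_sq, real_inner_self_eq_norm_sq] at hv
  have h1 : ‖v.1‖ ≤ 1 := by nlinarith [norm_nonneg v.1, sq_nonneg ‖vert B φ p v‖]
  have h2 : ‖vert B φ p v‖ ≤ 1 := by
    nlinarith [norm_nonneg (vert B φ p v), sq_nonneg ‖v.1‖]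
  have h3 : v.2 = vert B φ p v - L v.1 := by
    simp [hL]
  rw [mem_closedBall_zero_iff, Prod.norm_def, max_le_iff]
  refine ⟨by linarith [norm_nonneg L], ?_⟩
  rw [h3]
  refine (norm_sub_le _ _).trans (add_le_add h2 ((L.le_opNorm _).trans ?_))
  nlinarith [norm_nonneg L, norm_nonneg v.1]

lemma form_symm (B : Bracket m k) (φ : ℝ≥0 × ℝ≥0 → ℝ≥0) (p v w : Tot m k) :
    form B φ p v w = form B φ p w v := by
  rw [form_apply, form_apply, real_inner_comm, real_inner_comm (vert B φ p w)]

/-- The Riemannian metric `g^{[·,·],φ}` on `ℝ^{m+2k}`. -/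
def metric (B : Bracket m k) (φ : ℝ≥0 × ℝ≥0 → ℝ≥0) (hφ : SmoothOnQuadrant φ) :
    RMetric (Tot m k) :=
  RMetric.mk' (form B φ) (form_symm B φ) (form_pos B φ) (form_bounded B φ) (contDiff_form B hφ)

@[simp] lemma metric_inner (B : Bracket m k) (φ : ℝ≥0 × ℝ≥0 → ℝ≥0) (hφ : SmoothOnQuadrant φ)
    (p : Tot m k) : (metric B φ hφ).inner p = form B φ p := rfl

end TorusMetric

end

/-! The vertical correction in `vert` is tangent to the spheres in `u`, so `‖u‖²/2` has gradient
`(0, u)`. An isometry `τ` commuting with the torus preserves its fixed point set `u = 0`. Comparing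
speeds along the rays `t ↦ (x, t • u)`, for `τ` and its inverse, shows that `τ` preserves `‖u‖`
(`norm_snd`), hence also the radial field (`fderiv_radial`). Integrating that field, the first
component of `τ` depends on `x` alone and the second is linear in `u`.

On `u = 0` the metric is Euclidean, so the first component is a rigid motion `A x + a`. For large
`‖u‖` the metric is flat, which makes the second component independent of `x`; homogeneity carries
this to every `u`. A norm-preserving linear map commuting with the torus is a rotation `z`
(`exists_eq_rot`).

It remains to compare mixed products of `(Y, 0)` and `(0, W)`: `ψ • [x, Y]` is invariant under the
motion (`psi_smul_bracket`). Its support in `x` is bounded and symmetric, so `a = 0`; then `ψ`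
cancels and `A` preserves the bracket. -/

noncomputable section

namespace TorusMetric

variable {m k : ℕ}

/-! ### Torus action, fundamental fields and the inner products -/

/-- The rotation by an element of the torus, as a linear isometry of `ℝ^{2k}`. -/
def rotIsometry (z : Torus k) : R2k k →ₗᵢ[ℝ] R2k k where
  toFun := rot z
  map_add' u v := by ext j; simp [mul_add]
  map_smul' c u := by ext j; simp; ring
  norm_map' u := by
    change ‖rot z u‖ = ‖u‖
    simp [EuclideanSpace.norm_eq, Circle.norm_coe]

@[simp] lemma rotIsometry_apply (z : Torus k) (u : R2k k) : rotIsometry z u = rot z u := rfl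

@[simp] lemma rot_zero (z : Torus k) : rot z (0 : R2k k) = 0 := (rotIsometry z).map_zero

lemma norm_rot (z : Torus k) (u : R2k k) : ‖rot z u‖ = ‖u‖ := (rotIsometry z).norm_map u

lemma inner_rot_rot (z : Torus k) (u v : R2k k) :
    inner ℝ (rot z u) (rot z v) = inner ℝ u v := (rotIsometry z).inner_map_map u v

lemma rot_mul (z w : Torus k) (u : R2k k) : rot (z * w) u = rot z (rot w u) := by
  ext j; simp [mul_assoc]

@[simp] lemma torusAction_apply (z : Torus k) (p : Tot m k) :
    torusAction m k z p = (p.1, rot z p.2) := rfl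

lemma rot_fundamentalField (z : Torus k) (Z : EuclideanSpace ℝ (Fin k)) (u : R2k k) :
    rot z (fundamentalField Z u) = fundamentalField Z (rot z u) := by
  ext j; simp [fundamentalField_eq]; ring

@[simp] lemma fundamentalField_zero_left (u : R2k k) :
    fundamentalField (0 : EuclideanSpace ℝ (Fin k)) u = 0 := by
  ext j; simp [fundamentalField_eq]

@[simp] lemma fundamentalField_zero_right (Z : EuclideanSpace ℝ (Fin k)) :
    fundamentalField Z (0 : R2k k) = 0 := by
  ext j; simp [fundamentalField_eq]

/-- The orbits of the torus are tangent to the spheres. -/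
lemma inner_fundamentalField_self (Z : EuclideanSpace ℝ (Fin k)) (u : R2k k) :
    inner ℝ u (fundamentalField Z u) = 0 := by
  rw [PiLp.inner_apply]
  refine Finset.sum_eq_zero fun j _ => ?_
  simp [fundamentalField_eq, Complex.inner]
  ring

lemma inner_vert (B : Bracket m k) (φ : ℝ≥0 × ℝ≥0 → ℝ≥0) (p v : Tot m k) :
    inner ℝ p.2 (vert B φ p v) = inner ℝ p.2 v.2 := by
  rw [vert_apply, inner_sub_right, inner_smul_right, inner_fundamentalField_self, mul_zero,
    sub_zero]

/-- The gradient of `‖u‖² / 2` is the radial field `(0, u)`. -/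
lemma form_radial (B : Bracket m k) (φ : ℝ≥0 × ℝ≥0 → ℝ≥0) (p v : Tot m k) :
    form B φ p (0, p.2) v = inner ℝ p.2 v.2 := by
  rw [form_apply, ← inner_vert B φ p v]
  simp

lemma norm_vert_sq_le (B : Bracket m k) (φ : ℝ≥0 × ℝ≥0 → ℝ≥0) (p v : Tot m k) :
    ‖vert B φ p v‖ ^ 2 ≤ form B φ p v v := by
  rw [form_apply, real_inner_self_eq_norm_sq, real_inner_self_eq_norm_sq]
  nlinarith [sq_nonneg ‖v.1‖]

lemma form_left_cancel (B : Bracket m k) (φ : ℝ≥0 × ℝ≥0 → ℝ≥0) (p v w : Tot m k)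
    (h : ∀ y, form B φ p v y = form B φ p w y) : v = w := by
  by_contra hne
  have := form_pos B φ p (v - w) (sub_ne_zero.2 hne)
  simp [h] at this

lemma psi_eq_of_norm_eq {φ : ℝ≥0 × ℝ≥0 → ℝ≥0} {p q : Tot m k} (h1 : ‖p.1‖ = ‖q.1‖)
    (h2 : ‖p.2‖ = ‖q.2‖) : psi φ p = psi φ q := by
  have h1' : ‖p.1‖₊ = ‖q.1‖₊ := NNReal.eq h1
  have h2' : ‖p.2‖₊ = ‖q.2‖₊ := NNReal.eq h2
  simp [psi, h1', h2']

/-! ### Maps of product form -/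

lemma hasFDerivAt_prod_rot (A : Rm m ≃ₗᵢ[ℝ] Rm m) (a : Rm m) (z : Torus k)
    {τ : Tot m k → Tot m k} (hτ : ∀ x u, τ (x, u) = (A x + a, rot z u)) (p : Tot m k) :
    HasFDerivAt τ ((A.toContinuousLinearEquiv : Rm m →L[ℝ] Rm m).prodMap
      (rotIsometry z).toContinuousLinearMap) p := by
  have : τ = fun q => ((A.toContinuousLinearEquiv : Rm m →L[ℝ] Rm m).prodMap
      (rotIsometry z).toContinuousLinearMap) q + (a, 0) := by
    ext1 q
    rw [← Prod.mk.eta (p := q), hτ]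
    exact Prod.ext rfl (add_zero _).symm
  rw [this]
  exact (ContinuousLinearMap.hasFDerivAt _).add_const _

lemma fderiv_prod_rot (A : Rm m ≃ₗᵢ[ℝ] Rm m) (a : Rm m) (z : Torus k)
    {τ : Tot m k → Tot m k} (hτ : ∀ x u, τ (x, u) = (A x + a, rot z u)) (p v : Tot m k) :
    fderiv ℝ τ p v = (A v.1, rot z v.2) := by
  rw [(hasFDerivAt_prod_rot A a z hτ p).fderiv]; rfl

lemma contDiff_prod_rot (A : Rm m ≃ₗᵢ[ℝ] Rm m) (z : Torus k) {τ : Tot m k → Tot m k}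
    (hτ : ∀ x u, τ (x, u) = (A x, rot z u)) : ContDiff ℝ ∞ τ := by
  have : τ = ((A.toContinuousLinearEquiv : Rm m →L[ℝ] Rm m).prodMap
      (rotIsometry z).toContinuousLinearMap) := by
    ext1 q; rw [← Prod.mk.eta (p := q), hτ]; rfl
  rw [this]
  exact ContinuousLinearMap.contDiff _

/-- Since `ψ` depends only on norms and the torus is abelian, the differential intertwines the
vertical projections at `p` and `τ p`. -/
lemma mem_isometryGroup_of_prod_rot (B : Bracket m k) {φ : ℝ≥0 × ℝ≥0 → ℝ≥0}
    (hφ : SmoothOnQuadrant φ) (A : Rm m ≃ₗᵢ[ℝ] Rm m) (hA : ∀ x y, B (A x) (A y) = B x y)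
    (z : Torus k) {τ : Equiv.Perm (Tot m k)} (hτ : ∀ x u, τ (x, u) = (A x, rot z u)) :
    τ ∈ isometryGroup (metric B φ hφ) := by
  refine ⟨contDiff_prod_rot A z hτ, contDiff_prod_rot A.symm z⁻¹ fun x u => ?_, fun p v w => ?_⟩
  · rw [Equiv.symm_apply_eq, hτ, ← rot_mul]
    ext j <;> simp
  · have hv : ∀ v, vert B φ (A p.1, rot z p.2) (A v.1, rot z v.2) = rot z (vert B φ p v) := by
      intro v
      have h : psi φ ((A p.1, rot z p.2) : Tot m k) = psi φ p :=
        psi_eq_of_norm_eq (A.norm_map _) (norm_rot _ _)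
      rw [vert_apply, vert_apply, h, hA, ← rot_fundamentalField]
      simp only [← rotIsometry_apply, map_sub, map_smul]
    have hd : ∀ v, fderiv ℝ τ p v = (A v.1, rot z v.2) :=
      fderiv_prod_rot A 0 z (by simpa using hτ) p
    have hp : τ p = (A p.1, rot z p.2) := hτ p.1 p.2
    change form B φ (τ p) (fderiv ℝ τ p v) (fderiv ℝ τ p w) = form B φ p v w
    rw [hd, hd, hp, form_apply, form_apply, hv, hv, inner_rot_rot, A.inner_map_map]

/-! ### Isometries in the centralizer -/

/-- The isometries of the metric that commute with the torus. -/
structure IsEquivariantIsometry (B : Bracket m k) (φ : ℝ≥0 × ℝ≥0 → ℝ≥0)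
    (τ : Equiv.Perm (Tot m k)) : Prop where
  smooth : ContDiff ℝ ∞ τ
  smooth_symm : ContDiff ℝ ∞ τ.symm
  form_map : ∀ p v w, form B φ (τ p) (fderiv ℝ τ p v) (fderiv ℝ τ p w) = form B φ p v w
  comm : ∀ (z : Torus k) x u, τ (x, rot z u) = ((τ (x, u)).1, rot z (τ (x, u)).2)

lemma torusGroup_le_isometryGroup (B : Bracket m k) {φ : ℝ≥0 × ℝ≥0 → ℝ≥0}
    (hφ : SmoothOnQuadrant φ) : torusGroup m k ≤ isometryGroup (metric B φ hφ) := by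
  rintro _ ⟨z, rfl⟩
  exact mem_isometryGroup_of_prod_rot B hφ (LinearIsometryEquiv.refl ℝ _) (fun _ _ => rfl) z
    fun _ _ => rfl

lemma mem_centralizer_iff (B : Bracket m k) {φ : ℝ≥0 × ℝ≥0 → ℝ≥0}
    (hφ : SmoothOnQuadrant φ) (τ : Equiv.Perm (Tot m k)) :
    τ ∈ (Subgroup.centralizer ((torusGroup m k).subgroupOf (isometryGroup (metric B φ hφ)) :
        Set (isometryGroup (metric B φ hφ)))).map (isometryGroup (metric B φ hφ)).subtype ↔
      IsEquivariantIsometry B φ τ := by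
  constructor
  · rintro ⟨⟨σ, hσ⟩, h, rfl⟩
    refine ⟨hσ.1, hσ.2.1, hσ.2.2, fun z x u => ?_⟩
    have hz := torusGroup_le_isometryGroup B hφ ⟨z, rfl⟩
    have := h ⟨torusAction m k z, hz⟩ (Subgroup.mem_subgroupOf.2 ⟨z, rfl⟩)
    exact (DFunLike.congr_fun (congrArg Subtype.val this) (x, u)).symm
  · intro h
    refine ⟨⟨τ, h.smooth, h.smooth_symm, h.form_map⟩, ?_, rfl⟩
    rintro ⟨_, hσ⟩ ⟨z, rfl⟩
    refine Subtype.ext (Equiv.ext fun p => ?_)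
    exact (h.comm z p.1 p.2).symm

namespace IsEquivariantIsometry

variable {B : Bracket m k} {φ : ℝ≥0 × ℝ≥0 → ℝ≥0} {τ : Equiv.Perm (Tot m k)}

lemma hasFDerivAt (h : IsEquivariantIsometry B φ τ) (p : Tot m k) :
    HasFDerivAt τ (fderiv ℝ τ p) p := (h.smooth.differentiable (by simp) p).hasFDerivAt

lemma fderiv_comp_symm (h : IsEquivariantIsometry B φ τ) (p v : Tot m k) :
    fderiv ℝ τ p (fderiv ℝ τ.symm (τ p) v) = v := by
  have h1 : HasFDerivAt τ.symm (fderiv ℝ τ.symm (τ p)) (τ p) :=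
    (h.smooth_symm.differentiable (by simp) _).hasFDerivAt
  have h2 : HasFDerivAt τ (fderiv ℝ τ p) (τ.symm (τ p)) := by
    rw [Equiv.symm_apply_apply]; exact h.hasFDerivAt p
  have h3 := h2.comp _ h1
  rw [Equiv.self_comp_symm] at h3
  exact DFunLike.congr_fun (h3.unique (hasFDerivAt_id _)) v

lemma symm (h : IsEquivariantIsometry B φ τ) : IsEquivariantIsometry B φ τ.symm where
  smooth := h.smooth_symm
  smooth_symm := h.smooth
  form_map p v w := by
    obtain ⟨q, rfl⟩ := τ.surjective p
    have := h.form_map q (fderiv ℝ τ.symm (τ q) v) (fderiv ℝ τ.symm (τ q) w)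
    rw [h.fderiv_comp_symm, h.fderiv_comp_symm] at this
    rw [Equiv.symm_apply_apply]
    exact this.symm
  comm z x u := by
    rw [Equiv.symm_apply_eq, h.comm]
    simp

/-! ### Preservation of `‖u‖` and of the radial field -/

/-- The fixed point set of the torus is preserved. -/
lemma snd_apply_zero (h : IsEquivariantIsometry B φ τ) (x : Rm m) : (τ (x, 0)).2 = 0 := by
  -- The torus element `-1` fixes `(x, 0)`, so the second component equals its own negative.
  have h1 := congrArg Prod.snd (h.comm (fun _ => Circle.exp Real.pi) x 0)
  rw [rot_zero] at h1
  ext j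
  have h2 := congrArg (fun u : R2k k => u j) h1
  simp only [rot_apply, Circle.coe_exp, Complex.exp_pi_mul_I] at h2
  have h3 : (2 : ℂ) * (τ (x, 0)).2 j = 0 := by linear_combination h2
  simpa using h3

lemma hasDerivAt_smul (h : IsEquivariantIsometry B φ τ) (x : Rm m) (u : R2k k) (t : ℝ) :
    HasDerivAt (fun t : ℝ => τ (x, t • u)) (fderiv ℝ τ (x, t • u) (0, u)) t := by
  have h1 : HasDerivAt (fun t : ℝ => ((x, t • u) : Tot m k)) (0, u) t := by
    refine (hasDerivAt_const t x).prodMk ?_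
    simpa using (hasDerivAt_id t).smul_const u
  exact (h.hasFDerivAt _).comp_hasDerivAt t h1

/-- Along the image of the ray from `(x, 0)` to `(x, u)`, the norm of the second component starts at
zero and grows at rate at most the metric speed `‖u‖`. -/
lemma norm_snd_le (h : IsEquivariantIsometry B φ τ) (x : Rm m) (u : R2k k) :
    ‖(τ (x, u)).2‖ ≤ ‖u‖ := by
  refine le_of_forall_pos_le_add fun ε hε => ?_
  set G : ℝ → R2k k := fun t => (τ (x, t • u)).2 with hG
  set D : ℝ → Tot m k := fun t => fderiv ℝ τ (x, t • u) (0, u) with hD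
  have hGd : ∀ t, HasDerivAt G (D t).2 t := fun t =>
    (ContinuousLinearMap.snd ℝ (Rm m) (R2k k)).hasFDerivAt.comp_hasDerivAt t
      (h.hasDerivAt_smul x u t)
  have hpos : ∀ t, 0 < ε ^ 2 + ‖G t‖ ^ 2 := fun t => by positivity
  -- The regularization by `ε` avoids the non-differentiability of the norm where `G` vanishes, in
  -- particular at `t = 0`.
  have hq : ∀ t, HasDerivAt (fun t => √(ε ^ 2 + ‖G t‖ ^ 2))
      (2 * inner ℝ (G t) (D t).2 / (2 * √(ε ^ 2 + ‖G t‖ ^ 2))) t := fun t =>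
    ((hGd t).norm_sq.const_add (ε ^ 2)).sqrt (hpos t).ne'
  have hle : ∀ t, deriv (fun t => √(ε ^ 2 + ‖G t‖ ^ 2)) t ≤ ‖u‖ := fun t => by
    rw [(hq t).deriv]
    have hs := Real.sqrt_pos.2 (hpos t)
    rw [div_le_iff₀ (by positivity)]
    have h1 : inner ℝ (G t) (D t).2 ≤ ‖G t‖ * ‖u‖ := by
      -- Only the radial part matters, so the velocity may be replaced by its vertical part, which
      -- the metric length controls.
      rw [hG, ← inner_vert B φ]
      refine (real_inner_le_norm _ _).trans ?_
      gcongr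
      refine abs_le_of_sq_le_sq' ?_ (norm_nonneg _) |>.2
      refine (norm_vert_sq_le _ _ _ _).trans ?_
      rw [h.form_map, form_apply]
      simp
    have h2 : ‖G t‖ ≤ √(ε ^ 2 + ‖G t‖ ^ 2) := Real.le_sqrt_of_sq_le (by nlinarith)
    nlinarith [mul_le_mul_of_nonneg_right h2 (norm_nonneg u)]
  have key := image_sub_le_mul_sub_of_deriv_le (fun t => (hq t).differentiableAt) hle
    (zero_le_one' ℝ)
  have h0 : G 0 = 0 := by simp [hG, h.snd_apply_zero]
  have h1 : G 1 = (τ (x, u)).2 := by simp [hG]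
  rw [h0, h1] at key
  have h2 : ‖(τ (x, u)).2‖ ≤ √(ε ^ 2 + ‖(τ (x, u)).2‖ ^ 2) := Real.le_sqrt_of_sq_le (by nlinarith)
  have h3 : √(ε ^ 2 + ‖(0 : R2k k)‖ ^ 2) = ε := by simp [Real.sqrt_sq hε.le]
  linarith

lemma norm_snd (h : IsEquivariantIsometry B φ τ) (x : Rm m) (u : R2k k) :
    ‖(τ (x, u)).2‖ = ‖u‖ := by
  refine (h.norm_snd_le x u).antisymm ?_
  have := h.symm.norm_snd_le (τ (x, u)).1 (τ (x, u)).2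
  simpa using this

/-- The radial field is preserved. -/
lemma fderiv_radial (h : IsEquivariantIsometry B φ τ) (p : Tot m k) :
    fderiv ℝ τ p (0, p.2) = (0, (τ p).2) := by
  refine form_left_cancel B φ (τ p) _ _ fun y => ?_
  have hy := h.fderiv_comp_symm p y
  set v := fderiv ℝ τ.symm (τ p) y
  have h1 : HasFDerivAt (fun q => ‖(τ q).2‖ ^ 2)
      (2 • (innerSL ℝ (τ p).2).comp
        ((ContinuousLinearMap.snd ℝ (Rm m) (R2k k)).comp (fderiv ℝ τ p))) p :=
    (((ContinuousLinearMap.snd ℝ (Rm m) (R2k k)).hasFDerivAt).comp p (h.hasFDerivAt p)).norm_sq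
  have h2 : HasFDerivAt (fun q : Tot m k => ‖q.2‖ ^ 2)
      (2 • (innerSL ℝ p.2).comp (ContinuousLinearMap.snd ℝ (Rm m) (R2k k))) p :=
    ((ContinuousLinearMap.snd ℝ (Rm m) (R2k k)).hasFDerivAt).norm_sq
  have h3 : (fun q => ‖(τ q).2‖ ^ 2) = (fun q : Tot m k => ‖q.2‖ ^ 2) := by
    ext q; rw [← Prod.mk.eta (p := q), h.norm_snd]
  rw [h3] at h1
  have h4 := DFunLike.congr_fun (h1.unique h2) v
  simp only [smul_apply, ContinuousLinearMap.comp_apply, innerSL_apply_apply,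
    ContinuousLinearMap.coe_snd', hy, nsmul_eq_mul, Nat.cast_ofNat, mul_eq_mul_left_iff,
    OfNat.ofNat_ne_zero, or_false] at h4
  -- An isometry preserving a function preserves its gradient.
  rw [form_radial, h4, ← form_radial B φ, ← h.form_map p, hy]

lemma fderiv_radial_smul (h : IsEquivariantIsometry B φ τ) (x : Rm m) (u : R2k k) {t : ℝ}
    (ht : t ≠ 0) : fderiv ℝ τ (x, t • u) (0, u) = (0, t⁻¹ • (τ (x, t • u)).2) := by
  have h1 := h.fderiv_radial (x, t • u)
  have h2 : ((0, t • u) : Tot m k) = t • (0, u) := by simp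
  simp only [h2, map_smul] at h1
  rw [← smul_right_injective (Tot m k) ht |>.eq_iff, h1]
  simp [smul_smul, ht]

/-- The first component does not depend on `u`. -/
lemma fst_apply (h : IsEquivariantIsometry B φ τ) (x : Rm m) (u : R2k k) :
    (τ (x, u)).1 = (τ (x, 0)).1 := by
  have hd : ∀ t : ℝ, HasDerivAt (fun t : ℝ => (τ (x, t • u)).1)
      (fderiv ℝ τ (x, t • u) (0, u)).1 t := fun t =>
    (ContinuousLinearMap.fst ℝ (Rm m) (R2k k)).hasFDerivAt.comp_hasDerivAt t
      (h.hasDerivAt_smul x u t)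
  -- The ray is run backwards: `u = 0`, where `fderiv_radial_smul` does not apply, becomes the right
  -- endpoint, and there continuity suffices.
  have key := constant_of_has_deriv_right_zero (a := (0 : ℝ)) (b := 1)
    (f := fun t : ℝ => (τ (x, (1 - t) • u)).1) ?_ ?_ 1 (by simp)
  · simpa using key.symm
  · intro t _
    exact ((hd (1 - t)).scomp t ((hasDerivAt_id t).const_sub 1)).continuousAt.continuousWithinAt
  · intro t ht
    have h1 := (hd (1 - t)).scomp t ((hasDerivAt_id t).const_sub 1)
    rw [h.fderiv_radial_smul x u (sub_pos.2 ht.2).ne', smul_zero] at h1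
    exact h1.hasDerivWithinAt

/-- The second component is homogeneous, hence linear, in `u`. -/
lemma snd_apply (h : IsEquivariantIsometry B φ τ) (x : Rm m) (u : R2k k) :
    (τ (x, u)).2 = (fderiv ℝ τ (x, 0) (0, u)).2 := by
  set G : ℝ → R2k k := fun t => (τ (x, t • u)).2 with hG
  have hd : ∀ t : ℝ, HasDerivAt G (fderiv ℝ τ (x, t • u) (0, u)).2 t := fun t =>
    (ContinuousLinearMap.snd ℝ (Rm m) (R2k k)).hasFDerivAt.comp_hasDerivAt t
      (h.hasDerivAt_smul x u t)
  -- Preservation of the radial field reads `G' = t⁻¹ • G`, so `t⁻¹ • G` is constant for `t > 0`.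
  have hd' : ∀ t : ℝ, 0 < t → HasDerivAt (fun t => t⁻¹ • G t) 0 t := fun t ht => by
    have h1 := (hasDerivAt_inv ht.ne').smul (hd t)
    rw [h.fderiv_radial_smul x u ht.ne'] at h1
    have h2 : t⁻¹ • t⁻¹ • G t + -(t ^ 2)⁻¹ • G t = 0 := by
      rw [smul_smul, ← add_smul, ← sq, inv_pow, add_neg_cancel, zero_smul]
    exact h2 ▸ h1
  have hc : ∀ t ∈ Set.Ioi (0 : ℝ), t⁻¹ • G t = G 1 := by
    intro t ht
    have := (convex_Ioi (0 : ℝ)).is_const_of_fderivWithin_eq_zero (𝕜 := ℝ)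
      (f := fun t => t⁻¹ • G t) (fun s hs => (hd' s hs).differentiableAt.differentiableWithinAt)
      (fun s hs => ?_) ht (Set.mem_Ioi.2 one_pos)
    · simpa using this
    · rw [fderivWithin_eq_fderiv (isOpen_Ioi.uniqueDiffWithinAt hs) (hd' s hs).differentiableAt]
      ext
      simp [(hd' s hs).deriv]
  have h0 : G 0 = 0 := by simp [hG, h.snd_apply_zero]
  -- The constant is the difference quotient of `G` at `0`, hence its derivative there.
  have hlim := (hd 0).tendsto_slope_zero_right
  have hlim2 : Filter.Tendsto (fun t : ℝ => t⁻¹ • (G (0 + t) - G 0)) (nhdsWithin 0 (Set.Ioi 0))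
      (nhds (G 1)) := by
    refine tendsto_const_nhds.congr' ?_
    filter_upwards [self_mem_nhdsWithin] with t ht
    rw [zero_add, h0, sub_zero, hc t ht]
  have := tendsto_nhds_unique hlim2 hlim
  simpa [hG] using this

end IsEquivariantIsometry

/-! ### Commutant of the torus; consequence of compact support -/

/-- The commutant of the torus in the linear isometries of `ℝ^{2k}` is the torus. -/
lemma exists_eq_rot (M : R2k k →L[ℝ] R2k k) (hnorm : ∀ u, ‖M u‖ = ‖u‖)
    (hcomm : ∀ (z : Torus k) u, M (rot z u) = rot z (M u)) :
    ∃ z : Torus k, ∀ u, M u = rot z u := by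
  -- Acting by `-1` in the `i`-th circle alone fixes the `j`-th plane, so the `i`-th coordinate of
  -- its image equals its own negative.
  have hoff : ∀ i j (c : ℂ), i ≠ j → M (EuclideanSpace.single j c) i = 0 := by
    intro i j c hij
    have h1 : rot (Function.update (1 : Torus k) i (Circle.exp Real.pi))
        (EuclideanSpace.single j c) = EuclideanSpace.single j c := by
      ext l
      by_cases hl : l = j
      · subst hl; simp [Function.update_of_ne hij.symm]
      · simp [hl]
    have h2 := hcomm (Function.update (1 : Torus k) i (Circle.exp Real.pi))
      (EuclideanSpace.single j c)
    rw [h1] at h2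
    have h3 := congrArg (fun u : R2k k => u i) h2
    simp only [rot_apply, Function.update_self, Circle.coe_exp, Complex.exp_pi_mul_I] at h3
    have h4 : (2 : ℂ) * M (EuclideanSpace.single j c) i = 0 := by linear_combination h3
    simpa using h4
  have hdiag : ∀ j, ‖M (EuclideanSpace.single j 1) j‖ = 1 := by
    intro j
    have h1 : M (EuclideanSpace.single j 1)
        = EuclideanSpace.single j (M (EuclideanSpace.single j 1) j) := by
      ext i
      by_cases hi : i = j
      · subst hi; simp
      · simp [hi, hoff i j 1 hi]
    have h2 := hnorm (EuclideanSpace.single j 1)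
    rw [h1] at h2
    simpa using h2
  -- By the polar form of `c`, real linearity and equivariance give complex linearity on each plane.
  have hmul : ∀ j (c : ℂ), M (EuclideanSpace.single j c) j
      = M (EuclideanSpace.single j 1) j * c := by
    intro j c
    have h1 : (EuclideanSpace.single j c : R2k k)
        = ‖c‖ • rot (fun _ => Circle.exp c.arg) (EuclideanSpace.single j 1) := by
      ext i
      by_cases hi : i = j
      · subst hi; simp [Complex.norm_mul_exp_arg_mul_I]
      · simp [hi]
    rw [h1, map_smul, hcomm]
    have h2 := Complex.norm_mul_exp_arg_mul_I c
    simp only [PiLp.smul_apply, rot_apply, Circle.coe_exp, Complex.real_smul]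
    linear_combination M (EuclideanSpace.single j 1) j * h2
  refine ⟨fun j => ⟨M (EuclideanSpace.single j 1) j, by simp [Submonoid.unitSphere, hdiag]⟩,
    fun u => ?_⟩
  have hu : u = ∑ j, EuclideanSpace.single j (u j) := by
    ext i; simp
  ext i
  conv_lhs => rw [hu]
  rw [map_sum, WithLp.ofLp_sum, Finset.sum_apply, Finset.sum_eq_single i, hmul]
  · rfl
  · exact fun j _ hj => hoff i j _ hj.symm
  · simp

lemma exists_psi_eq_zero {φ : ℝ≥0 × ℝ≥0 → ℝ≥0} (hsupp : HasCompactSupport φ) :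
    ∃ R : ℝ, 0 < R ∧ ∀ p : Tot m k, R ≤ ‖p.1‖ ∨ R ≤ ‖p.2‖ → psi φ p = 0 := by
  obtain ⟨a, ha⟩ := (hsupp.isCompact.image continuous_fst).bddAbove
  obtain ⟨b, hb⟩ := (hsupp.isCompact.image continuous_snd).bddAbove
  have hlt : ∀ (c : ℝ≥0) (t : ℝ≥0), (c : ℝ) < t ^ 2 → c < t ^ 2 := fun c t h => by exact_mod_cast h
  -- Here `a` and `b` bound squared norms on the support; the summand `1` makes the square of this
  -- radius exceed both.
  refine ⟨1 + a + b, by positivity, fun p hp => ?_⟩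
  by_contra h
  have hmem : (‖p.1‖₊ ^ 2, ‖p.2‖₊ ^ 2) ∈ tsupport φ :=
    subset_tsupport _ fun h0 => h (by simp [psi, h0])
  have h1 := ha ⟨_, hmem, rfl⟩
  have h2 := hb ⟨_, hmem, rfl⟩
  have h1' : ‖p.1‖ ^ 2 ≤ a := by exact_mod_cast h1
  have h2' : ‖p.2‖ ^ 2 ≤ b := by exact_mod_cast h2
  have := a.coe_nonneg
  have := b.coe_nonneg
  rcases hp with hp | hp <;> nlinarith

/-! ### Action on `ℝ^m` and the product form of the isometry -/

namespace IsEquivariantIsometry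

variable {B : Bracket m k} {φ : ℝ≥0 × ℝ≥0 → ℝ≥0} {τ : Equiv.Perm (Tot m k)}

/-- The action on the fixed point set `ℝ^m` of the torus is `1`-Lipschitz. -/
lemma lipschitzWith_base (h : IsEquivariantIsometry B φ τ) :
    LipschitzWith 1 (fun x => (τ (x, 0)).1) := by
  have hd : ∀ x, HasFDerivAt (fun x => (τ (x, 0)).1)
      ((ContinuousLinearMap.fst ℝ (Rm m) (R2k k)).comp
        ((fderiv ℝ τ (x, 0)).comp (ContinuousLinearMap.inl ℝ (Rm m) (R2k k)))) x := fun x =>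
    (ContinuousLinearMap.fst ℝ (Rm m) (R2k k)).hasFDerivAt.comp x
      ((h.hasFDerivAt (x, 0)).comp x (hasFDerivAt_prodMk_left x 0))
  refine lipschitzWith_of_nnnorm_fderiv_le (𝕜 := ℝ) (fun x => (hd x).differentiableAt) fun x => ?_
  rw [(hd x).fderiv, ← NNReal.coe_le_coe, coe_nnnorm]
  refine ContinuousLinearMap.opNorm_le_bound _ zero_le_one fun Y => ?_
  have h1 := h.form_map (x, 0) (Y, 0) (Y, 0)
  -- Fundamental fields vanish at `u = 0`, so `(Y, 0)` has length `‖Y‖` there.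
  have h2 : vert B φ (x, 0) (Y, 0) = 0 := by simp
  rw [form_apply, form_apply, h2, inner_zero_left, add_zero, real_inner_self_eq_norm_sq,
    real_inner_self_eq_norm_sq, real_inner_self_eq_norm_sq] at h1
  rw [NNReal.coe_one, one_mul]
  refine (abs_le_of_sq_le_sq' ?_ (norm_nonneg _)).2
  change ‖(fderiv ℝ τ (x, 0) (Y, 0)).1‖ ^ 2 ≤ ‖Y‖ ^ 2
  nlinarith [sq_nonneg ‖vert B φ (τ (x, 0)) (fderiv ℝ τ (x, 0) (Y, 0))‖]

lemma apply_zero (h : IsEquivariantIsometry B φ τ) (x : Rm m) :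
    ((τ (x, 0)).1, (0 : R2k k)) = τ (x, 0) := Prod.ext rfl (h.snd_apply_zero x).symm

/-- Both `τ` and its inverse are `1`-Lipschitz on the fixed point set, so the induced map is a
surjective isometry of Euclidean space, affine by Mazur–Ulam. -/
lemma exists_fst_eq (h : IsEquivariantIsometry B φ τ) :
    ∃ (A : Rm m ≃ₗᵢ[ℝ] Rm m) (a : Rm m), ∀ x u, (τ (x, u)).1 = A x + a := by
  let e : Rm m ≃ᵢ Rm m :=
    { toFun := fun x => (τ (x, 0)).1
      invFun := fun x => (τ.symm (x, 0)).1
      left_inv := fun x => by simp [h.apply_zero]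
      right_inv := fun x => by simp [h.symm.apply_zero]
      isometry_toFun := by
        refine Isometry.of_dist_eq fun x y => le_antisymm ?_ ?_
        · simpa using h.lipschitzWith_base.dist_le_mul x y
        · have := h.symm.lipschitzWith_base.dist_le_mul (τ (x, 0)).1 (τ (y, 0)).1
          simpa [h.apply_zero] using this }
  refine ⟨e.toRealAffineIsometryEquiv.linearIsometryEquiv, e 0, fun x u => ?_⟩
  rw [h.fst_apply]
  change e x = _
  simpa using e.toRealAffineIsometryEquiv.map_vadd 0 x

lemma snd_smul (h : IsEquivariantIsometry B φ τ) (x : Rm m) (t : ℝ) (u : R2k k) :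
    (τ (x, t • u)).2 = t • (τ (x, u)).2 := by
  have h1 : ((0, t • u) : Tot m k) = t • (0, u) := by simp
  rw [h.snd_apply, h.snd_apply x u, h1, map_smul, Prod.smul_snd]

/-- The second component does not depend on `x`, as the metric is flat for large `u`. -/
lemma snd_eq (h : IsEquivariantIsometry B φ τ) (hsupp : HasCompactSupport φ) (x : Rm m)
    (u : R2k k) : (τ (x, u)).2 = (τ (0, u)).2 := by
  obtain ⟨R, hR0, hR⟩ := exists_psi_eq_zero (m := m) (k := k) hsupp
  obtain ⟨A, a, hA⟩ := h.exists_fst_eq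
  have hlarge : ∀ u : R2k k, R ≤ ‖u‖ → (τ (x, u)).2 = (τ (0, u)).2 := by
    intro u hu
    have hd : ∀ x, HasFDerivAt (fun x => τ (x, u))
        ((fderiv ℝ τ (x, u)).comp (ContinuousLinearMap.inl ℝ (Rm m) (R2k k))) x := fun x =>
      (h.hasFDerivAt (x, u)).comp x (hasFDerivAt_prodMk_left x u)
    have hd2 : ∀ x, HasFDerivAt (fun x => (τ (x, u)).2) (0 : Rm m →L[ℝ] R2k k) x := by
      intro x
      have h2 := (ContinuousLinearMap.snd ℝ (Rm m) (R2k k)).hasFDerivAt.comp x (hd x)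
      refine h2.congr_fderiv (ContinuousLinearMap.ext fun Y => ?_)
      have h3 : (fderiv ℝ τ (x, u) (Y, 0)).1 = A Y := by
        have h4 := (ContinuousLinearMap.fst ℝ (Rm m) (R2k k)).hasFDerivAt.comp x (hd x)
        have h5 : HasFDerivAt (fun x => (τ (x, u)).1)
            (A.toContinuousLinearEquiv : Rm m →L[ℝ] Rm m) x := by
          simp only [hA]
          exact A.toContinuousLinearEquiv.hasFDerivAt.add_const a
        exact DFunLike.congr_fun (h4.unique h5) Y
      -- With `ψ = 0` at both points, the image of `(Y, 0)` has squared length `‖Y‖²`; its first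
      -- component `A Y` already accounts for all of it.
      have h6 := h.form_map (x, u) (Y, 0) (Y, 0)
      have h7 : psi φ (τ (x, u)) = 0 := hR _ (Or.inr (by rwa [h.norm_snd]))
      have h8 : psi φ ((x, u) : Tot m k) = 0 := hR _ (Or.inr hu)
      rw [form_apply, form_apply, vert_apply, vert_apply, h7, h8, h3, A.inner_map_map] at h6
      change (fderiv ℝ τ (x, u) (Y, 0)).2 = 0
      simpa using h6
    exact is_const_of_fderiv_eq_zero (𝕜 := ℝ) (fun x => (hd2 x).differentiableAt)
      (fun x => (hd2 x).fderiv) x 0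
  by_cases hu : u = 0
  · rw [hu, h.snd_apply_zero, h.snd_apply_zero]
  · have hu' : ‖u‖ ≠ 0 := norm_ne_zero_iff.2 hu
    have h1 := hlarge ((R / ‖u‖) • u) (by
      rw [norm_smul, Real.norm_of_nonneg (by positivity), div_mul_cancel₀ _ hu'])
    rw [h.snd_smul, h.snd_smul] at h1
    exact smul_right_injective _ (div_ne_zero hR0.ne' hu') h1

theorem exists_eq_prod (h : IsEquivariantIsometry B φ τ) (hsupp : HasCompactSupport φ) :
    ∃ (A : Rm m ≃ₗᵢ[ℝ] Rm m) (a : Rm m) (z : Torus k),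
      ∀ x u, τ (x, u) = (A x + a, rot z u) := by
  obtain ⟨A, a, hA⟩ := h.exists_fst_eq
  let M : R2k k →L[ℝ] R2k k := (ContinuousLinearMap.snd ℝ (Rm m) (R2k k)).comp
    ((fderiv ℝ τ (0, 0)).comp (ContinuousLinearMap.inr ℝ (Rm m) (R2k k)))
  have hM : ∀ u, M u = (τ (0, u)).2 := fun u => (h.snd_apply 0 u).symm
  obtain ⟨z, hz⟩ := exists_eq_rot M (fun u => by rw [hM, h.norm_snd])
    (fun z u => by rw [hM, hM, h.comm])
  exact ⟨A, a, z, fun x u => Prod.ext (hA x u) (by rw [h.snd_eq hsupp, ← hM, hz])⟩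

/-! ### Comparison of the brackets -/

/-- The isometry preserves the horizontal distribution. -/
lemma psi_smul_fundamentalField (h : IsEquivariantIsometry B φ τ) {A : Rm m ≃ₗᵢ[ℝ] Rm m}
    {a : Rm m} {z : Torus k} (hτ : ∀ x u, τ (x, u) = (A x + a, rot z u)) (x Y : Rm m)
    (u : R2k k) :
    psi φ ((A x + a, u) : Tot m k) • fundamentalField (B (A x + a) (A Y)) u =
      psi φ ((x, u) : Tot m k) • fundamentalField (B x Y) u := by
  refine ext_inner_right ℝ fun W => ?_
  -- The pairing of `(Y, 0)` with a vertical `W` reads off the connection term.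
  have h1 := h.form_map (x, u) (Y, 0) (0, W)
  have h2 : psi φ ((A x + a, rot z u) : Tot m k) = psi φ ((A x + a, u) : Tot m k) :=
    psi_eq_of_norm_eq rfl (norm_rot z u)
  rw [fderiv_prod_rot A a z hτ, fderiv_prod_rot A a z hτ, hτ, form_apply, form_apply, vert_apply,
    vert_apply, vert_apply, vert_apply, h2] at h1
  simp only [rot_zero, map_zero, fundamentalField_zero_left, smul_zero, sub_zero, zero_sub,
    inner_neg_left, inner_zero_right, zero_add, neg_inj, ← rot_fundamentalField,
    inner_smul_left, inner_rot_rot] at h1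
  rw [inner_smul_left, inner_smul_left]
  exact h1

/-- When no coordinate of `u` vanishes, `Z ↦ Z^*_u` is injective and can be cancelled. -/
lemma psi_smul_bracket (h : IsEquivariantIsometry B φ τ) {A : Rm m ≃ₗᵢ[ℝ] Rm m}
    {a : Rm m} {z : Torus k} (hτ : ∀ x u, τ (x, u) = (A x + a, rot z u)) (x Y : Rm m)
    {u : R2k k} (hu : ∀ j, u j ≠ 0) :
    psi φ ((A x + a, u) : Tot m k) • B (A x + a) (A Y) = psi φ ((x, u) : Tot m k) • B x Y := by
  ext j
  have h1 := congrArg (fun v : R2k k => v j) (h.psi_smul_fundamentalField hτ x Y u)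
  simp only [fundamentalField_eq, PiLp.smul_apply, Complex.real_smul, ← mul_assoc,
    mul_eq_mul_right_iff, hu j, Complex.I_ne_zero, or_false] at h1
  simp only [PiLp.smul_apply, smul_eq_mul]
  exact_mod_cast h1

end IsEquivariantIsometry

/-! ### Exclusion of translations and conclusion -/

/-- A bounded nonempty set symmetric about the origin is invariant under a Euclidean motion only
if the motion fixes the origin. -/
lemma translation_eq_zero {E : Type*} [NormedAddCommGroup E] [NormedSpace ℝ E] {S : Set E}
    (hS : Bornology.IsBounded S) (hne : S.Nonempty) (hneg : ∀ x ∈ S, -x ∈ S) (A : E ≃ₗᵢ[ℝ] E)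
    (a : E) (hA : ∀ x, A x + a ∈ S ↔ x ∈ S) : a = 0 := by
  obtain ⟨y, hy⟩ := hne
  obtain ⟨R, hR⟩ := hS.exists_norm_le
  -- Inverse motion, `-1`, motion and `-1` compose to the translation by `-2a`, whose iterates leave
  -- every bounded set unless `a = 0`.
  have hsub : ∀ x ∈ S, x - (2 : ℝ) • a ∈ S := by
    intro x hx
    have h1 : A.symm (x - a) ∈ S := (hA _).1 (by simpa using hx)
    have h2 := hneg _ ((hA _).2 (hneg _ h1))
    convert h2 using 1
    rw [map_neg, A.apply_symm_apply, two_smul]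
    abel
  have hn : ∀ n : ℕ, y - (2 * n : ℝ) • a ∈ S := by
    intro n
    induction n with
    | zero => simpa using hy
    | succ n ih =>
      convert hsub _ ih using 1
      push_cast
      module
  by_contra ha
  obtain ⟨n, hn'⟩ := exists_nat_gt ((R + ‖y‖) / ‖a‖)
  rw [div_lt_iff₀ (norm_pos_iff.2 ha)] at hn'
  have h1 := hR _ (hn n)
  have h2 : ‖(2 * n : ℝ) • a‖ ≤ ‖y‖ + ‖y - (2 * n : ℝ) • a‖ := by
    have := norm_sub_le y (y - (2 * n : ℝ) • a)
    rwa [sub_sub_cancel] at this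
  rw [norm_smul, Real.norm_of_nonneg (by positivity)] at h2
  nlinarith [norm_nonneg a, norm_nonneg y, (Nat.cast_nonneg n : (0 : ℝ) ≤ n),
    mul_nonneg (Nat.cast_nonneg n : (0 : ℝ) ≤ n) (norm_nonneg a)]

lemma SmoothOnQuadrant.continuous {φ : ℝ≥0 × ℝ≥0 → ℝ≥0} (hφ : SmoothOnQuadrant φ) :
    Continuous φ := by
  have h1 : Continuous fun p : ℝ≥0 × ℝ≥0 => ((p.1, p.2) : ℝ × ℝ) := by fun_prop
  have h2 : Continuous fun p => (φ p : ℝ) := by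
    simpa [Function.comp_def] using
      (ContDiffOn.continuousOn hφ).comp_continuous h1 fun p => by simp
  exact continuous_induced_rng.2 h2

/-- By continuity, a point where `φ` is nonzero can be pushed diagonally off the boundary of the
quadrant. -/
lemma SmoothOnQuadrant.exists_pos {φ : ℝ≥0 × ℝ≥0 → ℝ≥0} (hφ : SmoothOnQuadrant φ)
    (hφ0 : φ ≠ 0) : ∃ s r : ℝ≥0, 0 < s ∧ 0 < r ∧ φ (s ^ 2, r ^ 2) ≠ 0 := by
  obtain ⟨⟨a, b⟩, hab⟩ := Function.ne_iff.1 hφ0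
  have h1 : Continuous fun ε : ℝ≥0 => φ (a + ε, b + ε) := hφ.continuous.comp (by fun_prop)
  have h2 : ∀ᶠ ε in nhds (0 : ℝ≥0), φ (a + ε, b + ε) ≠ 0 :=
    h1.continuousAt.eventually_ne (by simpa using hab)
  obtain ⟨ε, h3, h4⟩ := ((h2.filter_mono nhdsWithin_le_nhds).and
    (self_mem_nhdsWithin (s := Set.Ioi (0 : ℝ≥0)))).exists
  have hε : 0 < ε := h4
  exact ⟨NNReal.sqrt (a + ε), NNReal.sqrt (b + ε), by simp [hε], by simp [hε], by simpa using h3⟩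

theorem IsEquivariantIsometry.exists_eq_prod_rot {B : Bracket m k} {φ : ℝ≥0 × ℝ≥0 → ℝ≥0}
    {τ : Equiv.Perm (Tot m k)} (h : IsEquivariantIsometry B φ τ) (hB : B ≠ 0)
    (hφ : SmoothOnQuadrant φ) (hsupp : HasCompactSupport φ) (hφ0 : φ ≠ 0) :
    ∃ (A : Rm m ≃ₗᵢ[ℝ] Rm m) (z : Torus k),
      (∀ x y, B (A x) (A y) = B x y) ∧ ∀ x u, τ (x, u) = (A x, rot z u) := by
  obtain ⟨A, a, z, hτ⟩ := h.exists_eq_prod hsupp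
  obtain ⟨s, r, hs, hr, hsr⟩ := hφ.exists_pos hφ0
  obtain ⟨R, -, hR⟩ := exists_psi_eq_zero (m := m) (k := k) hsupp
  obtain ⟨x₀, y₀, hxy⟩ : ∃ x y, B x y ≠ 0 := by
    by_contra! hcon
    exact hB (LinearMap.ext₂ hcon)
  -- An index exists, so `k > 0` and the all-ones vector `w` below is nonzero.
  obtain ⟨j₀, -⟩ : ∃ j, B x₀ y₀ j ≠ 0 := by
    by_contra! hcon
    exact hxy (PiLp.ext hcon)
  obtain ⟨u, hu, hur⟩ : ∃ u : R2k k, (∀ j, u j ≠ 0) ∧ ‖u‖ = r := by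
    set w : R2k k := WithLp.toLp 2 fun _ => 1 with hw
    have hw0 : ‖w‖ ≠ 0 := norm_ne_zero_iff.2 fun h0 => by
      have := congrArg (fun v : R2k k => v j₀) h0
      simp [hw] at this
    refine ⟨((r : ℝ) / ‖w‖) • w, fun j => ?_, ?_⟩
    · exact smul_ne_zero (div_ne_zero (by exact_mod_cast hr.ne') hw0) one_ne_zero
    · rw [norm_smul, Real.norm_of_nonneg (by positivity), div_mul_cancel₀ _ hw0]
  have hψ : ∀ x : Rm m, ‖x‖ = s → psi φ ((x, u) : Tot m k) ≠ 0 := by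
    intro x hx
    have h1 : ‖x‖₊ = s := NNReal.eq hx
    have h2 : ‖u‖₊ = r := NNReal.eq hur
    simpa [psi, h1, h2] using hsr
  have key : ∀ x Y, psi φ ((A x + a, u) : Tot m k) • B (A x + a) (A Y) =
      psi φ ((x, u) : Tot m k) • B x Y := fun x Y => h.psi_smul_bracket hτ x Y hu
  have hscale : ∀ x : Rm m, x ≠ 0 → ∃ c : ℝ, c ≠ 0 ∧ ‖c • x‖ = s := fun x hx => by
    have hx' := norm_ne_zero_iff.2 hx
    refine ⟨s / ‖x‖, div_ne_zero (by exact_mod_cast hs.ne') hx', ?_⟩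
    rw [norm_smul, Real.norm_of_nonneg (by positivity), div_mul_cancel₀ _ hx']
  have ha : a = 0 := by
    refine translation_eq_zero (S := {x | ∃ Y, psi φ ((x, u) : Tot m k) • B x Y ≠ 0})
      ?_ ?_ ?_ A a ?_
    · refine (Metric.isBounded_closedBall (x := (0 : Rm m)) (r := R)).subset ?_
      rintro x ⟨Y, hY⟩
      rw [mem_closedBall_zero_iff]
      by_contra! hlt
      exact hY (by rw [hR (x, u) (Or.inl hlt.le), zero_smul])
    · obtain ⟨c, hc, hcs⟩ := hscale x₀ (by rintro rfl; simp at hxy)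
      refine ⟨c • x₀, y₀, smul_ne_zero (hψ _ hcs) ?_⟩
      rw [map_smul, LinearMap.smul_apply]
      exact smul_ne_zero hc hxy
    · rintro x ⟨Y, hY⟩
      have h1 : psi φ ((-x, u) : Tot m k) = psi φ ((x, u) : Tot m k) :=
        psi_eq_of_norm_eq (norm_neg x) rfl
      refine ⟨Y, ?_⟩
      rwa [h1, map_neg, LinearMap.neg_apply, smul_neg, neg_ne_zero]
    · intro x
      constructor
      · rintro ⟨Y, hY⟩
        refine ⟨A.symm Y, ?_⟩
        rwa [← key, A.apply_symm_apply]
      · rintro ⟨Y, hY⟩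
        exact ⟨A Y, by rwa [key]⟩
  subst ha
  simp only [add_zero] at hτ key
  refine ⟨A, z, fun x y => ?_, hτ⟩
  -- Scaling `x` to norm `s` makes the common factor `ψ` nonzero, and linearity then removes the
  -- scale.
  by_cases hx : x = 0
  · simp [hx]
  obtain ⟨c, hc, hcs⟩ := hscale x hx
  have h1 := key (c • x) y
  have h3 : psi φ ((A (c • x), u) : Tot m k) = psi φ ((c • x, u) : Tot m k) :=
    psi_eq_of_norm_eq (A.norm_map _) rfl
  rw [h3] at h1
  have h2 := smul_right_injective _ (hψ _ hcs) h1
  simp only [map_smul, LinearMap.smul_apply] at h2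
  exact smul_right_injective _ hc h2

end TorusMetric

end

open TorusMetric in
theorem corollary4p7 (m k : ℕ) (B : Bracket m k)
    (hskew : ∀ x y, B x y = -B y x) (hB : B ≠ 0)
    (φ : ℝ≥0 × ℝ≥0 → ℝ≥0) (hφ : SmoothOnQuadrant φ) (hsupp : HasCompactSupport φ) (hφ0 : φ ≠ 0) :
    torusGroup m k ≤ isometryGroup (metric B φ hφ) ∧
    ((Subgroup.centralizer ((torusGroup m k).subgroupOf (isometryGroup (metric B φ hφ)) :
        Set (isometryGroup (metric B φ hφ)))).map (isometryGroup (metric B φ hφ)).subtype :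
        Set (Equiv.Perm (Tot m k))) =
      {τ | ∃ (A : Rm m ≃ₗᵢ[ℝ] Rm m) (z : Torus k),
        (∀ x y, B (A x) (A y) = B x y) ∧ ∀ x u, τ (x, u) = (A x, rot z u)} := by
  refine ⟨torusGroup_le_isometryGroup B hφ, Set.ext fun τ => ?_⟩
  refine (mem_centralizer_iff B hφ τ).trans
    ⟨fun h => h.exists_eq_prod_rot hB hφ hsupp hφ0, ?_⟩
  rintro ⟨A, z, hA, hτ⟩
  have h := mem_isometryGroup_of_prod_rot B hφ A hA z hτ
  refine ⟨h.1, h.2.1, h.2.2, fun w x u => ?_⟩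
  -- Commutation with the torus holds because the torus is abelian.
  rw [hτ, hτ, ← rot_mul, ← rot_mul, mul_comm]
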